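/- Let $\mathcal{C}$ and $\mathcal{D}$ be abelian categories with enough projective objects, and let $F:\mathcal{C}\to\mathcal{D}$ and $G:\mathcal{D}\to\mathcal{C}$ be covariant functors forming a Frobenius pair $(F,G)$, that is, $G$ is both a left and a right adjoint of $F$. An object $M$ of an abelian category $\mathcal{A}$ with enough projective objects is called Gorenstein projective if there is an exact complex of projective objects $$\mathbf{P}:\ \cdots\to P_1\to P_0\to P^0\to P^1\to\cdots$$ with $M\cong\ker(P^0\to P^1)$ such that $\operatorname{Hom}_{\mathcal{A}}(\mathbf{P},Q)$ is exact for every projective object $Q$ of $\mathcal{A}$. The Gorenstein projective dimension $\mathrm{Gpd}(X)\in\{0,1,2,\dots\}\cup\{\infty\}$ of an object $X$ of $\mathcal{A}$ is defined by declaring that, for every integer $n\geq 0$, $\mathrm{Gpd}(X)\leq n$ if and only if there is an exact sequence $0\to G_n\to\cdots\to G_0\to X\to 0$ with all $G_i$ Gorenstein projective. If $F$ is faithful, then $\mathrm{Gpd}(X)=\mathrm{Gpd}(F(X))$ for every object $X$ of $\mathcal{C}$ (including the case where both sides are infinite). -/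

import Mathlib

open CategoryTheory Limits

universe v u v' u'

namespace GorensteinHomological

/-- The complex of abelian groups `Hom(P, Q)`, obtained by applying `Hom(-, Q)` to the cochain
complex `P`, is exact: at every degree `i`, in
`Hom(P.X (i + 1), Q) ⟶ Hom(P.X i, Q) ⟶ Hom(P.X (i - 1), Q)`
the kernel of the second map is the image of the first. -/
def HomExact {A : Type u} [Category.{v} A] [Preadditive A]
    (P : CochainComplex A ℤ) (Q : A) : Prop :=
  ∀ i : ℤ, Function.Exact
    (fun f : P.X (i + 1) ⟶ Q => P.d i (i + 1) ≫ f)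
    (fun f : P.X i ⟶ Q => P.d (i - 1) i ≫ f)

/-- `M` is Gorenstein projective: there is an exact complex `P` of projective objects, indexed by
`ℤ`, such that `Hom(P, Q)` is exact for every projective `Q` and `M ≅ ker (P.X 0 ⟶ P.X 1)`. -/
def IsGorensteinProjective {A : Type u} [Category.{v} A] [Abelian A] (M : A) : Prop :=
  ∃ P : CochainComplex A ℤ,
    (∀ i : ℤ, Projective (P.X i)) ∧ P.Acyclic ∧
    (∀ Q : A, Projective Q → HomExact P Q) ∧
    Nonempty (M ≅ kernel (P.d 0 1))

/-- There is an exact sequence `0 ⟶ G n ⟶ ⋯ ⟶ G 0 ⟶ X ⟶ 0` with all `G i` Gorenstein projective.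
The sequence is the acyclic chain complex `K`, with `X` in degree `0` and `G i` in
degree `i + 1`. -/
def HasGpdLE {A : Type u} [Category.{v} A] [Abelian A] (X : A) (n : ℕ) : Prop :=
  ∃ K : ChainComplex A ℕ,
    K.Acyclic ∧ Nonempty (K.X 0 ≅ X) ∧
    (∀ i : ℕ, i ≤ n → IsGorensteinProjective (K.X (i + 1))) ∧
    (∀ i : ℕ, n < i → IsZero (K.X (i + 1)))

/-- The Gorenstein projective dimension: the least `n` such that `HasGpdLE X n`, and `⊤` if there
is none. -/
noncomputable def Gpd {A : Type u} [Category.{v} A] [Abelian A] (X : A) : ℕ∞ :=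
  ⨅ (n : ℕ) (_ : HasGpdLE X n), (n : ℕ∞)

/-- `(F, G)` is a Frobenius pair: `G` is both a right and a left adjoint of `F`. -/
def IsFrobeniusPair {C : Type u} [Category.{v} C] {D : Type u'} [Category.{v'} D]
    (F : C ⥤ D) (G : D ⥤ C) : Prop :=
  Nonempty (F ⊣ G) ∧ Nonempty (G ⊣ F)

theorem isGorensteinProjective_of_isZero {A : Type u} [Category.{v} A] [Abelian A] {M : A}
    (hM : IsZero M) : IsGorensteinProjective M := by
  have h0 : ∀ i : ℤ, IsZero ((HomologicalComplex.zero : CochainComplex A ℤ).X i) := fun _ =>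
    isZero_zero A
  refine ⟨HomologicalComplex.zero, fun i => ?_, fun i => HomologicalComplex.ExactAt.of_isZero (h0 i), ?_, ?_⟩
  · exact Projective.of_iso ((isZero_zero A).iso (h0 i)) inferInstance
  · intro Q _ i f
    exact ⟨fun _ => ⟨0, (h0 _).eq_of_src _ _⟩, fun _ => (h0 _).eq_of_src _ _⟩
  · exact ⟨hM.iso (IsZero.of_mono (kernel.ι _) (h0 0))⟩

/-- `Gpd X ≤ n` holds exactly when the defining exact sequence of length `n` exists. -/
theorem gpd_le_iff {A : Type u} [Category.{v} A] [Abelian A] (X : A) (n : ℕ) :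
    Gpd X ≤ n ↔ HasGpdLE X n := by
  constructor
  · intro h
    have h' : ∃ m : ℕ, m ≤ n ∧ HasGpdLE X m := by
      by_contra! hc
      have : ((n + 1 : ℕ) : ℕ∞) ≤ Gpd X := by
        refine le_iInf₂ fun m hm => ?_
        by_contra hlt
        exact hc m (by have := not_le.1 hlt; norm_cast at this; omega) hm
      have := this.trans h
      norm_cast at this
      omega
    obtain ⟨m, hmn, K, hK, e, hG, hZ⟩ := h'
    refine ⟨K, hK, e, fun i _ => ?_, fun i hi => hZ i (by omega)⟩
    by_cases him : i ≤ m
    · exact hG i him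
    · exact isGorensteinProjective_of_isZero (hZ i (by omega))
  · intro h
    exact iInf₂_le n h

end GorensteinHomological

/-! Both functors of a Frobenius pair are exact and preserve projectives. Since projectives go to
projectives, the adjunction gives Ext(FX, Q) = 0 iff Ext(X, GQ) = 0 (`extVanish_adjunction`). Call
an object perp if its higher Ext into every projective vanishes (`IsPerp`). By `of_class`, any class
of perp objects in which each member embeds in a projective with cokernel in the class consists of
Gorenstein projectives. Hence F, and by symmetry G, preserves Gorenstein projectives and so
resolutions by them.

For the converse, faithfulness makes the unit X → GFX monic and each projective Q a retract of GFQ.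
If FX is Gorenstein projective, so is GFX; embed it in a projective P. The cokernel Y of X → GFX → P
is perp because maps X → Q extend to P through the retract. Then FY is Gorenstein projective by
`cokernel_of_isPerp`, and the construction repeats (`isGorensteinProjective_of_obj`). Larger
dimensions reduce to this case by passing to a syzygy (`GpdLE.syzygy`). -/

namespace GorensteinHomological

universe w w'

open Abelian

/-! ### Short exact sequences, pushouts and pullbacks -/

section ShortExact

variable {A : Type u} [Category.{v} A] [Abelian A]

/-- `0 ⟶ X ⟶ Y ⟶ Z ⟶ 0` is a short exact sequence. -/
def SES {X Y Z : A} (f : X ⟶ Y) (g : Y ⟶ Z) : Prop :=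
  ∃ w : f ≫ g = 0, (ShortComplex.mk f g w).ShortExact

namespace SES

variable {X Y Z : A} {f : X ⟶ Y} {g : Y ⟶ Z}

lemma zero (h : SES f g) : f ≫ g = 0 := h.1

lemma mono (h : SES f g) : Mono f := h.2.mono_f

lemma epi (h : SES f g) : Epi g := h.2.epi_g

lemma exists_lift (h : SES f g) {T : A} (k : T ⟶ Y) (hk : k ≫ g = 0) : ∃ l : T ⟶ X, l ≫ f = k :=
  have := h.mono
  ⟨h.2.exact.lift k hk, h.2.exact.lift_f k hk⟩

lemma exists_desc (h : SES f g) {T : A} (k : Y ⟶ T) (hk : f ≫ k = 0) : ∃ l : Z ⟶ T, g ≫ l = k :=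
  have := h.epi
  ⟨h.2.exact.desc k hk, h.2.exact.g_desc k hk⟩

lemma of_lift (hf : Mono f) (hg : Epi g) (w : f ≫ g = 0)
    (h : ∀ {T : A} (k : T ⟶ Y), k ≫ g = 0 → ∃ l : T ⟶ X, l ≫ f = k) : SES f g := by
  refine ⟨w, { exact := ?_ }⟩
  rw [ShortComplex.exact_iff_exact_up_to_refinements]
  intro T k hk
  obtain ⟨l, hl⟩ := h k hk
  exact ⟨T, 𝟙 T, inferInstance, l, by simpa using hl.symm⟩

lemma of_desc (hf : Mono f) (hg : Epi g) (w : f ≫ g = 0)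
    (h : ∀ {T : A} (k : Y ⟶ T), f ≫ k = 0 → ∃ l : Z ⟶ T, g ≫ l = k) : SES f g := by
  refine ⟨w, { exact := ?_ }⟩
  refine ShortComplex.exact_of_g_is_cokernel _
    (CokernelCofork.IsColimit.ofπ' g w fun k hk => ⟨(h k hk).choose, (h k hk).choose_spec⟩)

lemma cokernel (f : X ⟶ Y) [hf : Mono f] : SES f (cokernel.π f) :=
  of_desc hf inferInstance (cokernel.condition f) fun k hk =>
    ⟨cokernel.desc f k hk, cokernel.π_desc f k hk⟩

lemma kernel (g : Y ⟶ Z) [hg : Epi g] : SES (kernel.ι g) g :=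
  of_lift inferInstance hg (kernel.condition g) fun k hk =>
    ⟨kernel.lift g k hk, kernel.lift_ι g k hk⟩

lemma biprod (X Y : A) : SES (biprod.inl : X ⟶ X ⊞ Y) biprod.snd :=
  of_desc inferInstance inferInstance (by simp) fun k hk =>
    ⟨biprod.inr ≫ k, by ext <;> simp [hk]⟩

lemma biprod_map_id_left (h : SES f g) (P : A) :
    SES (biprod.map (𝟙 P) f) (biprod.snd ≫ g) := by
  have := h.mono
  have := h.epi
  refine of_lift inferInstance inferInstance (by simp [h.zero]) fun k hk => ?_
  obtain ⟨l, hl⟩ := h.exists_lift (k ≫ biprod.snd) (by simpa using hk)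
  exact ⟨biprod.lift (k ≫ biprod.fst) l, by ext <;> simp [hl]⟩

lemma biprod_map_id_right (h : SES f g) (P : A) :
    SES (f ≫ biprod.inr) (biprod.map (𝟙 P) g) := by
  have := h.mono
  have := h.epi
  refine of_desc inferInstance inferInstance (by ext <;> simp [h.zero]) fun k hk => ?_
  obtain ⟨l, hl⟩ := h.exists_desc (biprod.inr ≫ k) (by simpa using hk)
  exact ⟨biprod.desc (biprod.inl ≫ k) l, by ext <;> simp [hl]⟩

lemma iso_left (h : SES f g) {X' : A} (e : X' ≅ X) : SES (e.hom ≫ f) g := by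
  have := h.mono
  refine of_lift inferInstance h.epi (by simp [h.zero]) fun k hk => ?_
  obtain ⟨l, hl⟩ := h.exists_lift k hk
  exact ⟨l ≫ e.inv, by simp [hl]⟩

lemma iso_right (h : SES f g) {Z' : A} (e : Z ≅ Z') : SES f (g ≫ e.hom) := by
  have := h.epi
  refine of_lift h.mono inferInstance (by simp [reassoc_of% h.zero]) fun k hk => ?_
  exact h.exists_lift k (by simpa [← cancel_mono e.hom] using hk)

lemma iso_middle (h : SES f g) {Y' : A} (e : Y ≅ Y') : SES (f ≫ e.hom) (e.inv ≫ g) := by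
  have := h.epi
  have := h.mono
  refine of_lift inferInstance inferInstance (by simp [h.zero]) fun k hk => ?_
  obtain ⟨l, hl⟩ := h.exists_lift (k ≫ e.inv) (by simpa using hk)
  exact ⟨l, by simp [reassoc_of% hl]⟩

/-- Pushout of a short exact sequence along a morphism out of its left term. -/
lemma pushout_snd (h : SES f g) {R : A} (r : X ⟶ R) :
    ∃ g' : pushout f r ⟶ Z, pushout.inl f r ≫ g' = g ∧ SES (pushout.inr f r) g' := by
  have := h.mono
  have := h.epi
  have h1 : pushout.inl f r ≫ pushout.desc g 0 (by simp [h.zero]) = g :=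
    pushout.inl_desc _ _ _
  have : Epi (pushout.desc g 0 (by simp [h.zero]) : pushout f r ⟶ Z) :=
    epi_of_epi_fac h1
  refine ⟨_, h1,
    of_desc inferInstance inferInstance (by simp [pushout.inr_desc]) fun k hk => ?_⟩
  obtain ⟨l, hl⟩ := h.exists_desc (pushout.inl f r ≫ k) (by
    rw [pushout.condition_assoc, hk, comp_zero])
  exact ⟨l, by ext <;> simp [pushout.inl_desc_assoc, pushout.inr_desc_assoc, hl, hk]⟩

/-- Two short exact sequences with the same left term fit into a cross. -/
lemma exists_cross (h : SES f g) {R L : A} {r : X ⟶ R} {l : R ⟶ L} (h' : SES r l) :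
    ∃ (W : A) (a : R ⟶ W) (b : W ⟶ Z) (c : Y ⟶ W) (d : W ⟶ L), SES a b ∧ SES c d := by
  obtain ⟨b, -, hb⟩ := h.pushout_snd r
  obtain ⟨d, -, hd⟩ := h'.pushout_snd f
  exact ⟨_, _, _, _, _, hb, by simpa using
    (hd.iso_middle (pushoutSymmetry r f))⟩

/-- The dual of `exists_cross`: two short exact sequences with the same right term. -/
lemma exists_cross' (h : SES f g) {R L : A} {l : L ⟶ R} {r : R ⟶ Z} (h' : SES l r) :
    ∃ (W : A) (a : X ⟶ W) (b : W ⟶ R) (c : L ⟶ W) (d : W ⟶ Y), SES a b ∧ SES c d := by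
  have := h.epi
  have := h'.epi
  have := h.mono
  have := h'.mono
  have ha : pullback.lift f 0 (by simp [h.zero]) ≫ pullback.fst g r = f := pullback.lift_fst _ _ _
  have hc : pullback.lift 0 l (by simp [h'.zero]) ≫ pullback.snd g r = l := pullback.lift_snd _ _ _
  refine ⟨pullback g r, pullback.lift f 0 (by simp [h.zero]), pullback.snd _ _,
    pullback.lift 0 l (by simp [h'.zero]), pullback.fst _ _,
    of_lift (mono_of_mono_fac ha) inferInstance (by simp [pullback.lift_snd]) fun k hk => ?_,
    of_lift (mono_of_mono_fac hc) inferInstance (by simp [pullback.lift_fst]) fun k hk => ?_⟩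
  · obtain ⟨m, hm⟩ := h.exists_lift (k ≫ pullback.fst _ _) (by
      rw [Category.assoc, pullback.condition, reassoc_of% hk, zero_comp])
    exact ⟨m, by ext <;> simp [pullback.lift_fst, pullback.lift_snd, hm, hk]⟩
  · obtain ⟨m, hm⟩ := h'.exists_lift (k ≫ pullback.snd _ _) (by
      rw [Category.assoc, ← pullback.condition, reassoc_of% hk, zero_comp])
    exact ⟨m, by ext <;> simp [pullback.lift_fst, pullback.lift_snd, hm, hk]⟩

/-- The cokernels of two composable monomorphisms and of their composition. -/
lemma comp_mono (h : SES f g) {W V : A} {i : Y ⟶ W} {p : W ⟶ V} (h' : SES i p) :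
    ∃ (C : A) (q : W ⟶ C) (a : Z ⟶ C) (b : C ⟶ V), SES (f ≫ i) q ∧ SES a b := by
  have := h.mono
  have := h'.mono
  have := h.epi
  obtain ⟨b, -, hb⟩ := h'.pushout_snd g
  -- The pushout of `i` along `g` serves as the cokernel of `f ≫ i`.
  refine ⟨_, pushout.inl i g, _, b, of_desc inferInstance inferInstance ?_ fun k hk => ?_, hb⟩
  · rw [Category.assoc, pushout.condition, reassoc_of% h.zero, zero_comp]
  · obtain ⟨l, hl⟩ := h.exists_desc (i ≫ k) (by simpa using hk)
    exact ⟨pushout.desc k l hl.symm, by simp [pushout.inl_desc]⟩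

/-- The kernels of two composable epimorphisms and of their composition. -/
lemma comp_epi (h : SES f g) {W V : A} {p : W ⟶ Y} {i : V ⟶ W} (h' : SES i p) :
    ∃ (K : A) (q : K ⟶ W) (a : V ⟶ K) (b : K ⟶ X), SES q (p ≫ g) ∧ SES a b := by
  have := h.mono
  have := h'.mono
  have := h.epi
  have := h'.epi
  have ha : pullback.lift i 0 (by simp [h'.zero]) ≫ pullback.fst p f = i := pullback.lift_fst _ _ _
  refine ⟨pullback p f, pullback.fst _ _, pullback.lift i 0 (by simp [h'.zero]), pullback.snd _ _,
    of_lift inferInstance inferInstance ?_ fun k hk => ?_,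
    of_lift (mono_of_mono_fac ha) inferInstance (by simp [pullback.lift_snd]) fun k hk => ?_⟩
  · rw [pullback.condition_assoc, h.zero, comp_zero]
  · obtain ⟨l, hl⟩ := h.exists_lift (k ≫ p) (by simpa using hk)
    exact ⟨pullback.lift k l hl.symm, by simp [pullback.lift_fst]⟩
  · obtain ⟨m, hm⟩ := h'.exists_lift (k ≫ pullback.fst _ _) (by
      rw [Category.assoc, pullback.condition, reassoc_of% hk, zero_comp])
    exact ⟨m, by ext <;> simp [pullback.lift_fst, pullback.lift_snd, hm, hk]⟩

/-- A retraction of the left morphism splits a short exact sequence. -/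
lemma nonempty_iso_biprod (h : SES f g) (r : Y ⟶ X) (hr : f ≫ r = 𝟙 X) :
    Nonempty (Y ≅ X ⊞ Z) :=
  have := h.epi
  have hs := (ShortComplex.Splitting.ofExactOfRetraction (ShortComplex.mk f g h.1) h.2.exact r hr
    this)
  ⟨hs.isoBinaryBiproduct⟩

/-- A section of the right morphism splits a short exact sequence. -/
lemma nonempty_iso_biprod_of_section (h : SES f g) (s : Z ⟶ Y) (hs : s ≫ g = 𝟙 Z) :
    Nonempty (Y ≅ X ⊞ Z) :=
  have := h.mono
  have hs := (ShortComplex.Splitting.ofExactOfSection (ShortComplex.mk f g h.1) h.2.exact s hs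
    this)
  ⟨hs.isoBinaryBiproduct⟩

lemma map (h : SES f g) {B : Type u'} [Category.{v'} B] [Abelian B] (F : A ⥤ B) [F.Additive]
    [PreservesFiniteLimits F] [PreservesFiniteColimits F] : SES (F.map f) (F.map g) :=
  ⟨by rw [← F.map_comp, h.1, F.map_zero], h.2.map_of_exact F⟩

end SES

end ShortExact

/-! ### Vanishing of Ext and dimension shifting -/

section Ext

variable {A : Type u} [Category.{v} A] [Abelian A] [HasExt.{w} A]

/-- `Ext^{n+1}(X, Q) = 0`. -/
def ExtVanish (X Q : A) (n : ℕ) : Prop := ∀ e : Ext.{w} X Q (n + 1), e = 0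

lemma ExtVanish.of_projective (X Q : A) [Projective X] (n : ℕ) : ExtVanish.{v, u, w} X Q n :=
  fun e => e.eq_zero_of_projective

lemma ExtVanish.of_retract_right {X Q Q' : A} {n : ℕ} (h : ExtVanish.{v, u, w} X Q n)
    (r : Retract Q' Q) : ExtVanish.{v, u, w} X Q' n := by
  intro e
  have h1 := h (e.comp (Ext.mk₀ r.i) (add_zero _))
  have h2 : (e.comp (Ext.mk₀ r.i) (add_zero _)).comp (Ext.mk₀ r.r) (add_zero _) = e := by
    rw [Ext.comp_assoc_of_second_deg_zero, Ext.mk₀_comp_mk₀, r.retract, Ext.comp_mk₀_id]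
  rw [← h2, h1, Ext.zero_comp]

lemma ExtVanish.of_retract_left {X X' Q : A} {n : ℕ} (h : ExtVanish.{v, u, w} X Q n)
    (r : Retract X' X) : ExtVanish.{v, u, w} X' Q n := by
  intro e
  have h1 := h ((Ext.mk₀ r.r).comp e (zero_add _))
  have h2 : (Ext.mk₀ r.i).comp ((Ext.mk₀ r.r).comp e (zero_add _)) (zero_add _) = e := by
    rw [Ext.mk₀_comp_mk₀_assoc, r.retract, Ext.mk₀_id_comp]
  rw [← h2, h1, Ext.comp_zero]

namespace SES

variable {X Y Z : A} {f : X ⟶ Y} {g : Y ⟶ Z}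

lemma exists_extension (h : SES f g) {Q : A} (hZ : ExtVanish.{v, u, w} Z Q 0) (k : X ⟶ Q) :
    ∃ l : Y ⟶ Q, f ≫ l = k := by
  obtain ⟨x, hx⟩ := Ext.contravariant_sequence_exact₁ h.2 Q (Ext.mk₀ k) (n₁ := 1) rfl (hZ _)
  obtain ⟨l, rfl⟩ := Ext.addEquiv₀.symm.surjective x
  refine ⟨l, Ext.addEquiv₀.symm.injective ?_⟩
  simpa using hx

lemma extVanish_zero_right (h : SES f g) {Q : A} (hY : ExtVanish.{v, u, w} Y Q 0)
    (hX : ∀ k : X ⟶ Q, ∃ l : Y ⟶ Q, f ≫ l = k) : ExtVanish.{v, u, w} Z Q 0 := by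
  intro e
  obtain ⟨x, rfl⟩ := Ext.contravariant_sequence_exact₃ h.2 Q e (hY _) (n₀ := 0) rfl
  obtain ⟨k, rfl⟩ := Ext.addEquiv₀.symm.surjective x
  obtain ⟨l, rfl⟩ := hX k
  have : Ext.addEquiv₀.symm (f ≫ l) = (Ext.mk₀ f).comp (Ext.mk₀ l) (zero_add 0) := by simp
  rw [this]
  -- The class `e` is the connecting image of `f ≫ l`, and the extension class followed by `f` is
  -- zero.
  exact h.2.extClass_comp_assoc _ 

lemma extVanish_succ_right (h : SES f g) {Q : A} {n : ℕ} (hY : ExtVanish.{v, u, w} Y Q (n + 1))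
    (hX : ExtVanish.{v, u, w} X Q n) : ExtVanish.{v, u, w} Z Q (n + 1) := by
  intro e
  obtain ⟨x, rfl⟩ := Ext.contravariant_sequence_exact₃ h.2 Q e (hY _) (n₀ := n + 1) (by omega)
  rw [hX x, Ext.comp_zero]

lemma extVanish_left (h : SES f g) {Q : A} {n : ℕ} (hY : ExtVanish.{v, u, w} Y Q n)
    (hZ : ExtVanish.{v, u, w} Z Q (n + 1)) : ExtVanish.{v, u, w} X Q n := by
  intro e
  obtain ⟨x, rfl⟩ := Ext.contravariant_sequence_exact₁ h.2 Q e (n₁ := n + 2) (by omega) (hZ _)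
  rw [hY x, Ext.comp_zero]

end SES

end Ext

/-! ### Ext vanishing across an adjunction -/

section Adjunction

variable {A : Type u} [Category.{v} A] [Abelian A] [HasExt.{w} A]
  {B : Type u'} [Category.{v'} B] [Abelian B]

/-- `L` carries a projective presentation of `X` to one of `L.obj X`. Vanishing of Ext¹ means that
maps extend along the syzygy inclusion, a condition preserved by the hom bijection; higher degrees
follow by dimension shifting. -/
lemma extVanish_adjunction [HasExt.{w'} B] [EnoughProjectives A] {L : A ⥤ B} {R : B ⥤ A}
    (adj : L ⊣ R) [L.Additive] [PreservesFiniteLimits L] [PreservesFiniteColimits L]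
    [R.PreservesEpimorphisms] (Q : B) (n : ℕ) :
    ∀ X : A, ExtVanish.{v', u', w'} (L.obj X) Q n ↔ ExtVanish.{v, u, w} X (R.obj Q) n := by
  induction n with
  | zero =>
    intro X
    have h := SES.kernel (Projective.π X)
    have h' := h.map L
    have : Projective (L.obj (Projective.over X)) := adj.map_projective _ inferInstance
    constructor
    · intro hX
      refine h.extVanish_zero_right (.of_projective _ _ _) fun k => ?_
      obtain ⟨l, hl⟩ := h'.exists_extension hX ((adj.homEquiv _ _).symm k)
      refine ⟨adj.homEquiv _ _ l, ?_⟩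
      rw [← adj.homEquiv_naturality_left, hl, Equiv.apply_symm_apply]
    · intro hX
      refine h'.extVanish_zero_right (.of_projective _ _ _) fun k => ?_
      obtain ⟨l, hl⟩ := h.exists_extension hX (adj.homEquiv _ _ k)
      refine ⟨(adj.homEquiv _ _).symm l, ?_⟩
      rw [← adj.homEquiv_naturality_left_symm, hl, Equiv.symm_apply_apply]
  | succ n ih =>
    intro X
    have h := SES.kernel (Projective.π X)
    have h' := h.map L
    have : Projective (L.obj (Projective.over X)) := adj.map_projective _ inferInstance
    constructor
    · intro hX
      exact h.extVanish_succ_right (.of_projective _ _ _)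
        ((ih _).1 (h'.extVanish_left (.of_projective _ _ _) hX))
    · intro hX
      exact h'.extVanish_succ_right (.of_projective _ _ _)
        ((ih _).2 (h.extVanish_left (.of_projective _ _ _) hX))

end Adjunction


/-! ### Acyclic complexes as spliced short exact sequences -/

section Complexes

variable {A : Type u} [Category.{v} A] [Abelian A]

lemma SES.of_exactAt {ι : Type*} {c : ComplexShape ι} (K : HomologicalComplex A c) {i j : ι}
    (hij : c.Rel i j) (h : K.ExactAt j) : SES (K.iCycles i) (K.toCycles i j) := by
  have hepi : Epi (K.toCycles i j) := by
    rw [epi_iff_surjective_up_to_refinements]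
    intro T z
    have h' := (K.exactAt_iff' i j (c.next j) (c.prev_eq' hij) rfl).1 h
    rw [ShortComplex.exact_iff_exact_up_to_refinements] at h'
    have hz : (z ≫ K.iCycles j) ≫ K.d j (c.next j) = 0 := by
      rw [Category.assoc, K.iCycles_d, comp_zero]
    obtain ⟨T', π, hπ, (x : T' ⟶ K.X i), (hx : π ≫ z ≫ K.iCycles j = x ≫ K.d i j)⟩ :=
      h' (z ≫ K.iCycles j) hz
    exact ⟨T', π, hπ, x, by simp [← cancel_mono (K.iCycles j), hx]⟩
  refine SES.of_lift inferInstance hepi ?_ fun k hk => ?_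
  · rw [← cancel_mono (K.iCycles j), Category.assoc, K.toCycles_i, K.iCycles_d, zero_comp]
  · refine ⟨K.liftCycles k j (c.next_eq' hij) ?_, K.liftCycles_i _ _ _ _⟩
    rw [← K.toCycles_i, reassoc_of% hk, zero_comp]

lemma SES.exact_comp {X Y Z Y' Z' Y'' : A} {f : X ⟶ Y} {g : Y ⟶ Z} {f' : Z ⟶ Y'} {g' : Y' ⟶ Z'}
    {f'' : Z' ⟶ Y''} (h : SES f g) (h' : SES f' g') [Mono f''] {d : Y ⟶ Y'} {d' : Y' ⟶ Y''}
    (hd : d = g ≫ f') (hd' : d' = g' ≫ f'') (w : d ≫ d' = 0) :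
    (ShortComplex.mk d d' w).Exact := by
  have := h.epi
  subst hd hd'
  rw [ShortComplex.exact_iff_exact_up_to_refinements]
  intro T x hx
  obtain ⟨l, hl⟩ := h'.exists_lift x (by
    rw [← cancel_mono f'', zero_comp, Category.assoc]
    exact hx)
  obtain ⟨T', π, hπ, y, hy⟩ := surjective_up_to_refinements_of_epi g l
  exact ⟨T', π, hπ, y, by rw [← hl, ← Category.assoc, hy, Category.assoc]⟩

/-- A complete projective resolution of `M`, as a sequence of short exact sequences. -/
def HasCompleteResolution (M : A) : Prop :=
  ∃ (Z E : ℤ → A) (f : ∀ i, Z i ⟶ E i) (g : ∀ i, E i ⟶ Z (i + 1)),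
    (∀ i, Projective (E i)) ∧ (∀ i, SES (f i) (g i)) ∧
    (∀ i (Q : A), Projective Q → ∀ k : Z i ⟶ Q, ∃ l, f i ≫ l = k) ∧ Nonempty (M ≅ Z 0)

lemma IsGorensteinProjective.hasCompleteResolution {M : A} (h : IsGorensteinProjective M) :
    HasCompleteResolution M := by
  obtain ⟨P, hP, hex, hhom, ⟨e⟩⟩ := h
  have hS (i : ℤ) : SES (P.iCycles i) (P.toCycles i (i + 1)) := SES.of_exactAt P (by simp) (hex _)
  refine ⟨fun i => P.cycles i, fun i => P.X i, fun i => P.iCycles i, fun i => P.toCycles i (i + 1),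
    hP, hS, fun i Q hQ k => ?_, ⟨e ≪≫ (kernelIsKernel _).conePointUniqueUpToIso
      (P.cyclesIsKernel 0 1 (by simp))⟩⟩
  obtain ⟨j, rfl⟩ : ∃ j, j + 1 = i := ⟨i - 1, by simp⟩
  have hepi := (hS j).epi
  obtain ⟨l, hl⟩ := (hhom Q hQ j (P.toCycles j (j + 1) ≫ k)).1 (by
    dsimp only
    rw [← P.toCycles_i, Category.assoc, reassoc_of% (hS j).zero, zero_comp, comp_zero])
  refine ⟨l, ?_⟩
  dsimp only at hl
  rw [← cancel_epi (P.toCycles j (j + 1)), ← hl, P.toCycles_i_assoc]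

/-- Hom-exactness of the spliced complex comes from extension: a map killed by the incoming
differential vanishes on the cycles because `g i` is epi, so it descends to the next cycles and then
extends to the next term. -/
lemma HasCompleteResolution.isGorensteinProjective {M : A} (h : HasCompleteResolution M) :
    IsGorensteinProjective M := by
  obtain ⟨Z, E, f, g, hE, hS, hQ, ⟨e⟩⟩ := h
  have hmono (i : ℤ) : Mono (f i) := (hS i).mono
  have hepi (i : ℤ) : Epi (g i) := (hS i).epi
  have sq (i : ℤ) : (g i ≫ f (i + 1)) ≫ g (i + 1) ≫ f (i + 1 + 1) = 0 := by
    simp [reassoc_of% (hS (i + 1)).zero]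
  let P : CochainComplex A ℤ := CochainComplex.of E (fun i => g i ≫ f (i + 1)) sq
  have hd (i : ℤ) : P.d i (i + 1) = g i ≫ f (i + 1) :=
    CochainComplex.of_d E (fun i => g i ≫ f (i + 1)) i
  refine ⟨P, hE, fun j => ?_, fun Q hQp j => ?_, ⟨e ≪≫ ?_⟩⟩
  · obtain ⟨i, rfl⟩ : ∃ i, i + 1 = j := ⟨j - 1, by simp⟩
    rw [P.exactAt_iff' i (i + 1) (i + 1 + 1) (by simp) (by simp)]
    exact SES.exact_comp (hS i) (hS (i + 1)) (hd i) (hd (i + 1)) _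
  · obtain ⟨i, rfl⟩ : ∃ i, i + 1 = j := ⟨j - 1, by simp⟩
    have key (k : E (i + 1) ⟶ Q) : P.d i (i + 1) ≫ k = 0 ↔
        ∃ l : E (i + 1 + 1) ⟶ Q, P.d (i + 1) (i + 1 + 1) ≫ l = k := by
      rw [hd, hd]
      constructor
      · intro hk
        obtain ⟨m, hm⟩ := (hS (i + 1)).exists_desc k (by
          rw [← cancel_epi (g i), comp_zero, ← hk, Category.assoc])
        obtain ⟨l, hl⟩ := hQ (i + 1 + 1) Q hQp m
        exact ⟨l, by rw [Category.assoc, hl, hm]⟩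
      · rintro ⟨l, rfl⟩
        exact by simp [reassoc_of% (hS (i + 1)).zero]
    have hi : i + 1 - 1 = i := by simp
    intro k
    dsimp only
    rw [hi]
    exact key k
  · have hd0 : P.d 0 1 = g 0 ≫ f 1 := hd 0
    refine (KernelFork.IsLimit.ofι' (f 0) (f := P.d 0 1) ?_ fun k hk =>
      ⟨((hS 0).exists_lift k ?_).choose, ((hS 0).exists_lift k ?_).choose_spec⟩
        ).conePointUniqueUpToIso (limit.isLimit (parallelPair (P.d 0 1) 0))
    · rw [hd0, reassoc_of% (hS 0).zero, zero_comp]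
    all_goals
      rw [← cancel_mono (f (0 + 1)), zero_comp, Category.assoc]
      exact (hd0 ▸ hk :)

end Complexes


/-! ### Two-sided chains by choice -/

lemma exists_int_chain {α : Type*} {W : α → Prop} {R : α → α → Prop}
    (hn : ∀ x, W x → ∃ y, W y ∧ R x y) (hp : ∀ x, W x → ∃ y, W y ∧ R y x) {x : α} (hx : W x) :
    ∃ Z : ℤ → α, Z 0 = x ∧ ∀ i, W (Z i) ∧ R (Z i) (Z (i + 1)) := by
  choose! s hs using hn
  choose! p hp using hp
  have hs' (n : ℕ) : W (s^[n] x) := by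
    induction n with
    | zero => exact hx
    | succ n ih => rw [Function.iterate_succ_apply']; exact (hs _ ih).1
  have hp' (n : ℕ) : W (p^[n] x) := by
    induction n with
    | zero => exact hx
    | succ n ih => rw [Function.iterate_succ_apply']; exact (hp _ ih).1
  let Z : ℤ → α := fun i => match i with
    | Int.ofNat n => s^[n] x
    | Int.negSucc n => p^[n + 1] x
  -- Including `n = 0` covers the step from -1 to 0, where the two halves of the chain meet.
  have hneg (n : ℕ) : Z (-(n : ℤ)) = p^[n] x := by
    cases n <;> rfl
  refine ⟨Z, rfl, fun i => ?_⟩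
  match i with
  | Int.ofNat n =>
    refine ⟨hs' n, ?_⟩
    change R (s^[n] x) (s^[n + 1] x)
    rw [Function.iterate_succ_apply']
    exact (hs _ (hs' n)).2
  | Int.negSucc n =>
    refine ⟨hp' (n + 1), ?_⟩
    have : Int.negSucc n + 1 = -(n : ℤ) := by omega
    rw [this, hneg]
    change R (p^[n + 1] x) _
    rw [Function.iterate_succ_apply']
    exact (hp _ (hp' n)).2

/-! ### The left orthogonal of the projectives and Gorenstein projective objects -/

section

variable {A : Type u} [Category.{v} A] [Abelian A]

/-- `Ext^i(X, Q) = 0` for all `i > 0` and all projective `Q`. -/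
def IsPerp (X : A) : Prop :=
  haveI := HasExt.standard A
  ∀ Q : A, Projective Q → ∀ n, ExtVanish.{v, u, max u v} X Q n

namespace IsPerp

lemma of_projective (X : A) [Projective X] : IsPerp X :=
  haveI := HasExt.standard A
  fun _ _ _ => .of_projective _ _ _

variable {X Y Z : A} {f : X ⟶ Y} {g : Y ⟶ Z}

lemma exists_extension (hZ : IsPerp Z) (h : SES f g) {Q : A} [Projective Q] (k : X ⟶ Q) :
    ∃ l : Y ⟶ Q, f ≫ l = k :=
  have := HasExt.standard A
  h.exists_extension (hZ Q inferInstance 0) k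

lemma right (hX : IsPerp X) (h : SES f g) [Projective Y]
    (hk : ∀ (Q : A), Projective Q → ∀ k : X ⟶ Q, ∃ l : Y ⟶ Q, f ≫ l = k) : IsPerp Z := by
  intro Q hQ n
  have := HasExt.standard A
  cases n with
  | zero => exact h.extVanish_zero_right (.of_projective _ _ _) (hk Q hQ)
  | succ n => exact h.extVanish_succ_right (.of_projective _ _ _) (hX Q hQ n)

lemma left (hY : IsPerp Y) (hZ : IsPerp Z) (h : SES f g) : IsPerp X :=
  haveI := HasExt.standard A
  fun Q hQ n => h.extVanish_left (hY Q hQ n) (hZ Q hQ (n + 1))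

/-- A short exact sequence that starts in a projective object and ends in an object of the left
orthogonal of the projectives splits. -/
lemma nonempty_iso_biprod (hZ : IsPerp Z) (h : SES f g) [Projective X] : Nonempty (Y ≅ X ⊞ Z) := by
  obtain ⟨r, hr⟩ := hZ.exists_extension h (𝟙 X)
  exact h.nonempty_iso_biprod r hr

end IsPerp

namespace IsGorensteinProjective

lemma of_iso {M N : A} (h : IsGorensteinProjective M) (e : N ≅ M) : IsGorensteinProjective N := by
  obtain ⟨P, h1, h2, h3, ⟨e'⟩⟩ := h
  exact ⟨P, h1, h2, h3, ⟨e ≪≫ e'⟩⟩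

/-- Extension of maps from `Z j` to `E j` kills Ext¹ of `Z (j + 1)`; each higher degree at `Z (j +
1)` shifts down to `Z j`. The induction therefore runs over all cycles at once. -/
lemma isPerp {M : A} (h : IsGorensteinProjective M) : IsPerp M := by
  intro Q hQ n
  have := HasExt.standard A
  obtain ⟨Z, E, f, g, hE, hS, hZ, ⟨e⟩⟩ := h.hasCompleteResolution
  have key (n : ℕ) : ∀ i, ExtVanish.{v, u, max u v} (Z i) Q n := by
    induction n with
    | zero =>
      intro i
      obtain ⟨j, rfl⟩ : ∃ j, j + 1 = i := ⟨i - 1, by simp⟩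
      exact (hS j).extVanish_zero_right (.of_projective _ _ _) (hZ j Q hQ)
    | succ n ih =>
      intro i
      obtain ⟨j, rfl⟩ : ∃ j, j + 1 = i := ⟨i - 1, by simp⟩
      exact (hS j).extVanish_succ_right (.of_projective _ _ _) (ih j)
  exact (key n 0).of_retract_left ⟨e.hom, e.inv, e.hom_inv_id⟩

lemma exists_cosyzygy {M : A} (h : IsGorensteinProjective M) :
    ∃ (P N : A) (f : M ⟶ P) (g : P ⟶ N),
      Projective P ∧ SES f g ∧ IsGorensteinProjective N := by
  obtain ⟨Z, E, f, g, hE, hS, hZ, ⟨e⟩⟩ := h.hasCompleteResolution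
  exact ⟨E 0, Z 1, e.hom ≫ f 0, g 0, hE 0, (hS 0).iso_left e,
    HasCompleteResolution.isGorensteinProjective
      ⟨fun i => Z (i + 1), fun i => E (i + 1), fun i => f (i + 1), fun i => g (i + 1),
        fun i => hE _, fun i => hS _, fun i => hZ _, ⟨Iso.refl _⟩⟩⟩

variable [EnoughProjectives A]

/-- Coinduction principle for Gorenstein projective objects. -/
lemma of_class (W : A → Prop) (hW : ∀ X, W X → IsPerp X)
    (hW' : ∀ X, W X → ∃ (P Y : A) (f : X ⟶ P) (g : P ⟶ Y), Projective P ∧ SES f g ∧ W Y)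
    {M : A} (hM : W M) : IsGorensteinProjective M := by
  -- `V` is the union of all admissible classes. It is closed under cosyzygies and, since adjoining
  -- one projective syzygy keeps a class admissible, under syzygies too, so a chain extends in both
  -- directions.
  let I : (A → Prop) → Prop := fun V => (∀ X, V X → IsPerp X) ∧ ∀ X, V X →
    ∃ (P Y : A) (f : X ⟶ P) (g : P ⟶ Y), Projective P ∧ SES f g ∧ V Y
  let V : A → Prop := fun X => ∃ U, I U ∧ U X
  let R : A → A → Prop := fun X Y =>
    ∃ (P : A) (f : X ⟶ P) (g : P ⟶ Y), Projective P ∧ SES f g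
  have hn (X : A) (hX : V X) : ∃ Y, V Y ∧ R X Y := by
    obtain ⟨U, hU, hX⟩ := hX
    obtain ⟨P, Y, f, g, hP, h, hY⟩ := hU.2 X hX
    exact ⟨Y, ⟨U, hU, hY⟩, P, f, g, hP, h⟩
  have hp (X : A) (hX : V X) : ∃ Y, V Y ∧ R Y X := by
    obtain ⟨U, hU, hX⟩ := hX
    have h := SES.kernel (Projective.π X)
    refine ⟨kernel (Projective.π X), ⟨fun Y => U Y ∨ Y = kernel (Projective.π X), ⟨?_, ?_⟩,
      .inr rfl⟩, _, _, _, inferInstance, h⟩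
    · rintro Y (hY | rfl)
      · exact hU.1 Y hY
      · exact (IsPerp.of_projective _).left (hU.1 X hX) h
    · rintro Y (hY | rfl)
      · obtain ⟨P, Y', f, g, hP, h, hY'⟩ := hU.2 Y hY
        exact ⟨P, Y', f, g, hP, h, .inl hY'⟩
      · exact ⟨_, X, _, _, inferInstance, h, .inl hX⟩
  obtain ⟨Z, rfl, hZ⟩ := exists_int_chain hn hp (x := M) ⟨W, ⟨hW, hW'⟩, hM⟩
  choose hV E f g hE hS using hZ
  refine HasCompleteResolution.isGorensteinProjective
    ⟨Z, E, f, g, hE, hS, fun i Q hQ k => ?_, ⟨Iso.refl _⟩⟩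
  obtain ⟨U, hU, h⟩ := hV (i + 1)
  exact (hU.1 _ h).exists_extension (hS i) k

/-- The kernel of an epimorphism from a projective to a Gorenstein projective object. -/
lemma of_ses_projective {X P Y : A} {f : X ⟶ P} {g : P ⟶ Y} (hY : IsGorensteinProjective Y)
    [Projective P] (h : SES f g) : IsGorensteinProjective X := by
  refine of_class (fun Z => IsGorensteinProjective Z ∨ Z = X) ?_ ?_ (.inr rfl)
  · rintro Z (hZ | rfl)
    · exact hZ.isPerp
    · exact (IsPerp.of_projective P).left hY.isPerp h
  · rintro Z (hZ | rfl)
    · obtain ⟨P, N, f, g, hP, h, hN⟩ := hZ.exists_cosyzygy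
      exact ⟨P, N, f, g, hP, h, .inl hN⟩
    · exact ⟨P, Y, f, g, inferInstance, h, .inl hY⟩

lemma of_projective (P : A) [Projective P] : IsGorensteinProjective P := by
  refine (isGorensteinProjective_of_isZero (isZero_zero A)).of_ses_projective (f := 𝟙 P) (g := 0)
    (SES.of_lift inferInstance ⟨fun _ _ _ => (isZero_zero A).eq_of_src _ _⟩ (by simp)
      fun k _ => ⟨k, by simp⟩)

lemma biprod_projective {X : A} (hX : IsGorensteinProjective X) (P : A) [Projective P] :
    IsGorensteinProjective (P ⊞ X) := by
  obtain ⟨Q, N, f, g, hQ, h, hN⟩ := hX.exists_cosyzygy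
  exact hN.of_ses_projective (h.biprod_map_id_left P)

/-- Gorenstein projective objects are closed under kernels of epimorphisms. -/
lemma of_ses {X H G : A} {f : X ⟶ H} {g : H ⟶ G} (hH : IsGorensteinProjective H)
    (hG : IsGorensteinProjective G) (h : SES f g) : IsGorensteinProjective X := by
  refine of_class (fun X => ∃ (H G : A) (f : X ⟶ H) (g : H ⟶ G),
    IsGorensteinProjective H ∧ IsGorensteinProjective G ∧ SES f g) ?_ ?_ ⟨H, G, f, g, hH, hG, h⟩
  · rintro X ⟨H, G, f, g, hH, hG, h⟩
    exact hH.isPerp.left hG.isPerp h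
  · rintro X ⟨H, G, f, g, hH, hG, h⟩
    obtain ⟨P, N, i, p, hP, h', hN⟩ := hH.exists_cosyzygy
    -- `C = P/X` is an extension of `N` by `G`. Pushing out along `G → Q` gives `T ≅ Q ⊞ N`, with
    -- `C` the kernel of `T → L`, so `C` stays in the class.
    obtain ⟨C, q, a, b, hq, hab⟩ := h.comp_mono h'
    obtain ⟨Q, L, r, l, hQ, hrl, hL⟩ := hG.exists_cosyzygy
    obtain ⟨T, a', b', c, d, h1, h2⟩ := hab.exists_cross hrl
    obtain ⟨e⟩ := hN.isPerp.nonempty_iso_biprod h1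
    exact ⟨P, C, _, q, hP, hq, T, L, c, d, (hN.biprod_projective Q).of_iso e, hL, h2⟩

/-- A cokernel of a monomorphism from a Gorenstein projective to a projective object is Gorenstein
projective as soon as it lies in the left orthogonal of the projectives. -/
lemma cokernel_of_isPerp {X P Y : A} {f : X ⟶ P} {g : P ⟶ Y} (hX : IsGorensteinProjective X)
    [Projective P] (h : SES f g) (hY : IsPerp Y) : IsGorensteinProjective Y := by
  obtain ⟨R, L, r, l, hR, hrl, hL⟩ := hX.exists_cosyzygy
  -- Both sequences through the pushout split, so `R ⊞ Y ≅ T ≅ P ⊞ L`, a Gorenstein projective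
  -- object.
  obtain ⟨T, a, b, c, d, h1, h2⟩ := h.exists_cross hrl
  obtain ⟨e⟩ := hY.nonempty_iso_biprod h1
  obtain ⟨e'⟩ := hL.isPerp.nonempty_iso_biprod h2
  have hT : IsGorensteinProjective (Y ⊞ R) :=
    (hL.biprod_projective P).of_iso (biprod.braiding _ _ ≪≫ e.symm ≪≫ e')
  obtain ⟨Q, N, i, p, hQ, hip, hN⟩ := hT.exists_cosyzygy
  -- The summand `R` is now removed: `Q/Y` is an extension of `N` by `R`, which splits, and `Y` is
  -- the kernel of `Q → Q/Y`.
  obtain ⟨C, q, a', b', hq, hab⟩ := (SES.biprod Y R).comp_mono hip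
  obtain ⟨e''⟩ := hN.isPerp.nonempty_iso_biprod hab
  exact ((hN.biprod_projective R).of_iso e'').of_ses_projective hq

end IsGorensteinProjective
end

/-! ### Gorenstein projective dimension by recursion on syzygies -/

section Dimension

open scoped ZeroObject

variable {A : Type u} [Category.{v} A] [Abelian A]

/-- Gorenstein projective dimension at most `n`, by recursion on `n`. -/
def GpdLE : ℕ → A → Prop
  | 0, X => IsGorensteinProjective X
  | n + 1, X => ∃ (K H : A) (f : K ⟶ H) (g : H ⟶ X),
      IsGorensteinProjective H ∧ SES f g ∧ GpdLE n K

lemma GpdLE.of_iso {n : ℕ} {X Y : A} (h : GpdLE n X) (e : Y ≅ X) : GpdLE n Y := by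
  cases n with
  | zero => exact IsGorensteinProjective.of_iso h e
  | succ n =>
    obtain ⟨K, H, f, g, hH, h, hK⟩ := h
    exact ⟨K, H, f, g ≫ e.inv, hH, h.iso_right e.symm, hK⟩

lemma HasGpdLE.gpdLE {n : ℕ} {X : A} (h : HasGpdLE X n) : GpdLE n X := by
  obtain ⟨K, hK, ⟨e⟩, hG, hz⟩ := h
  have hS (i : ℕ) : SES (K.iCycles (i + 1)) (K.toCycles (i + 1) i) :=
    SES.of_exactAt K (by simp) (hK _)
  -- The cycles in degree `i` are the `i`-th syzygy of `X`; at `i = n` they are isomorphic to `K.X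
  -- (n + 1)`, because `K.X (n + 2)` is zero.
  have key (m : ℕ) : ∀ i, i + m = n → GpdLE m (K.cycles i) := by
    induction m with
    | zero =>
      rintro i rfl
      have hi := (hS i).epi
      have hmono : Mono (K.toCycles (i + 1) i) := by
        have := (hS (i + 1)).epi
        refine Preadditive.mono_of_cancel_zero _ fun k hk => ?_
        obtain ⟨l, rfl⟩ := (hS i).exists_lift k hk
        rw [(IsZero.of_epi (K.toCycles (i + 1 + 1) (i + 1)) (hz (i + 1) (by omega))).eq_of_tgt l 0,
          zero_comp]
      have := isIso_of_mono_of_epi (K.toCycles (i + 1) i)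
      exact (hG i (by omega)).of_iso (asIso (K.toCycles (i + 1) i)).symm
    | succ m ih =>
      intro i hi
      exact ⟨_, _, _, _, hG i (by omega), hS i, ih (i + 1) (by omega)⟩
  have : IsIso (K.iCycles 0) := K.isIso_iCycles 0 _ rfl (K.shape _ _ (by simp))
  exact (key n 0 (by omega)).of_iso (e.symm ≪≫ (asIso (K.iCycles 0)).symm)

/-- A sequence of short exact sequences `Z (i + 1) ⟶ E i ⟶ Z i` starting at `X`, in which `E i`
satisfies `p i`. -/
def HasLeftResolution (p : ℕ → A → Prop) (X : A) : Prop :=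
  ∃ (Z E : ℕ → A) (f : ∀ i, Z (i + 1) ⟶ E i) (g : ∀ i, E i ⟶ Z i),
    Nonempty (Z 0 ≅ X) ∧ (∀ i, SES (f i) (g i)) ∧ ∀ i, p i (E i)

lemma HasLeftResolution.cons {p : ℕ → A → Prop} {K H X : A} {f₀ : K ⟶ H} {g₀ : H ⟶ X}
    (hK : HasLeftResolution (fun i => p (i + 1)) K) (hH : p 0 H) (h : SES f₀ g₀) :
    HasLeftResolution p X := by
  obtain ⟨Z, E, f, g, ⟨e⟩, hS, hp⟩ := hK
  let Z' : ℕ → A := fun i => match i with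
    | 0 => X
    | i + 1 => Z i
  let E' : ℕ → A := fun i => match i with
    | 0 => H
    | i + 1 => E i
  let f' : ∀ i, Z' (i + 1) ⟶ E' i := fun i => match i with
    | 0 => e.hom ≫ f₀
    | i + 1 => f i
  let g' : ∀ i, E' i ⟶ Z' i := fun i => match i with
    | 0 => g₀
    | i + 1 => g i
  refine ⟨Z', E', f', g', ⟨Iso.refl _⟩, fun i => ?_, fun i => ?_⟩
  · match i with
    | 0 => exact h.iso_left e
    | i + 1 => exact hS i
  · match i with
    | 0 => exact hH
    | i + 1 => exact hp i

lemma GpdLE.hasLeftResolution {n : ℕ} : ∀ {X : A}, GpdLE n X →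
    HasLeftResolution (fun i E => (i ≤ n → IsGorensteinProjective E) ∧ (n < i → IsZero E)) X := by
  induction n with
  | zero =>
    intro X hX
    have h0 : SES (0 : (0 : A) ⟶ 0) (0 : (0 : A) ⟶ 0) :=
      SES.of_lift ⟨fun _ _ _ => (isZero_zero A).eq_of_tgt _ _⟩
        ⟨fun _ _ _ => (isZero_zero A).eq_of_src _ _⟩ (by simp)
        fun k _ => ⟨k, (isZero_zero A).eq_of_tgt _ _⟩
    have h : SES (0 : (0 : A) ⟶ X) (𝟙 X) :=
      SES.of_lift ⟨fun _ _ _ => (isZero_zero A).eq_of_tgt _ _⟩ inferInstance (by simp)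
        fun k hk => ⟨0, by simpa using hk.symm⟩
    refine HasLeftResolution.cons ⟨fun _ => (0 : A), fun _ => (0 : A), fun _ => 0, fun _ => 0,
      ⟨Iso.refl _⟩, fun _ => h0, fun i => ⟨fun hi => ?_, fun _ => isZero_zero A⟩⟩
      ⟨fun _ => hX, fun hi => ?_⟩ h
    all_goals omega
  | succ n ih =>
    rintro X ⟨K, H, f, g, hH, h, hK⟩
    refine HasLeftResolution.cons ?_ ⟨fun _ => hH, fun hi => by omega⟩ h
    simpa using ih hK

lemma GpdLE.hasGpdLE {n : ℕ} {X : A} (h : GpdLE n X) : HasGpdLE X n := by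
  obtain ⟨Z, E, f, g, ⟨e⟩, hS, hp⟩ := h.hasLeftResolution
  have hmono (i : ℕ) : Mono (f i) := (hS i).mono
  have hepi (i : ℕ) : Epi (g i) := (hS i).epi
  let Y : ℕ → A := fun i => match i with
    | 0 => Z 0
    | i + 1 => E i
  let d : ∀ i, Y (i + 1) ⟶ Y i := fun i => match i with
    | 0 => g 0
    | i + 1 => g (i + 1) ≫ f i
  have sq (i : ℕ) : d (i + 1) ≫ d i = 0 := by
    match i with
    | 0 => exact by simp [d, (hS 0).zero]
    | i + 1 => exact by simp [d, reassoc_of% (hS (i + 1)).zero]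
  let K : ChainComplex A ℕ := ChainComplex.of Y d sq
  have hd (i : ℕ) : K.d (i + 1) i = d i := by simp [K]
  refine ⟨K, fun i => ?_, ⟨e⟩, fun i => (hp i).1, fun i => (hp i).2⟩
  match i with
  | 0 =>
    rw [K.exactAt_iff' 1 0 0 (by simp) (by simp), ShortComplex.exact_iff_epi]
    · exact (hd 0 ▸ hepi 0 : Epi (K.d 1 0))
    · exact K.shape 0 0 (by simp)
  | 1 =>
    rw [K.exactAt_iff' 2 1 0 (by simp) (by simp)]
    -- The last differential is `g 0` itself, with no inclusion after it, hence the identity as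
    -- `f''`.
    exact SES.exact_comp (f'' := 𝟙 _) (hS 1) (hS 0) (hd 1) ((hd 0).trans (Category.comp_id _).symm)
      _
  | i + 2 =>
    rw [K.exactAt_iff' (i + 3) (i + 2) (i + 1) (by simp) (by simp)]
    exact SES.exact_comp (hS (i + 2)) (hS (i + 1)) (hd (i + 2)) (hd (i + 1)) _

variable [EnoughProjectives A]

lemma GpdLE.biprod_projective {n : ℕ} : ∀ {X : A}, GpdLE n X → ∀ (P : A) [Projective P],
    GpdLE n (P ⊞ X) := by
  cases n with
  | zero => exact fun h P _ => IsGorensteinProjective.biprod_projective h P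
  | succ n =>
    rintro X ⟨K, H, f, g, hH, h, hK⟩ P _
    exact ⟨K, P ⊞ H, _, _, hH.biprod_projective P, h.biprod_map_id_right P, hK⟩

/-- Given a first step `V → W → H`, the kernel of `W → H → G` is Gorenstein projective and maps onto
`K` with kernel `V`. -/
lemma GpdLE.of_ses {n : ℕ} {K H G : A} {f : K ⟶ H} {g : H ⟶ G} (hH : GpdLE n H)
    (hG : IsGorensteinProjective G) (h : SES f g) : GpdLE n K := by
  cases n with
  | zero => exact IsGorensteinProjective.of_ses hH hG h
  | succ n =>
    obtain ⟨V, W, i, p, hW, h', hV⟩ := hH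
    obtain ⟨T, q, a, b, hq, hab⟩ := h.comp_epi h'
    exact ⟨V, T, a, b, hW.of_ses hG hq, hab, hV⟩

/-- A Schanuel argument: the pullback of `P` and `W` over `X` splits as `V ⊞ P`, and `K` is the
kernel of its projection to `W`. A bound from some Gorenstein resolution thus passes to any
projective syzygy. -/
lemma GpdLE.syzygy {n : ℕ} {K P X : A} {f : K ⟶ P} {g : P ⟶ X} (hX : GpdLE (n + 1) X)
    [Projective P] (h : SES f g) : GpdLE n K := by
  obtain ⟨V, W, i, p, hW, h', hV⟩ := hX
  obtain ⟨T, a, b, c, d, h1, h2⟩ := h.exists_cross' h'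
  have := h2.epi
  obtain ⟨e⟩ := h2.nonempty_iso_biprod_of_section (Projective.factorThru (𝟙 P) d) (by simp)
  exact ((hV.biprod_projective P).of_iso (e ≪≫ biprod.braiding _ _)).of_ses hW h1

end Dimension

/-! ### Transfer along a Frobenius pair -/

section Frobenius

lemma IsFrobeniusPair.symm {C : Type u} [Category.{v} C] {D : Type u'} [Category.{v'} D]
    {F : C ⥤ D} {G : D ⥤ C} (h : IsFrobeniusPair F G) : IsFrobeniusPair G F :=
  ⟨h.2, h.1⟩

/-- If `F` is faithful, then every projective object `Q` is a retract of `G.obj (F.obj Q)`. -/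
lemma IsFrobeniusPair.nonempty_retract {C : Type u} [Category.{v} C] {D : Type u'}
    [Category.{v'} D] {F : C ⥤ D} {G : D ⥤ C} (h : IsFrobeniusPair F G) [F.Faithful]
    (Q : C) [Projective Q] : Nonempty (Retract Q (G.obj (F.obj Q))) :=
  -- As a faithful right adjoint of `G`, `F` has an epic counit `G.obj (F.obj Q) ⟶ Q`, which splits
  -- over the projective `Q`.
  ⟨⟨Projective.factorThru (𝟙 Q) (h.2.some.counit.app Q), h.2.some.counit.app Q, by simp⟩⟩

variable {C : Type u} [Category.{v} C] [Abelian C] {D : Type u'} [Category.{v'} D] [Abelian D]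

/-- Both functors in a Frobenius pair are exact. -/
lemma IsFrobeniusPair.exists_preserves {F : C ⥤ D} {G : D ⥤ C} (h : IsFrobeniusPair F G) :
    F.Additive ∧ PreservesFiniteLimits F ∧ PreservesFiniteColimits F := by
  obtain ⟨⟨adj⟩, ⟨adj'⟩⟩ := h
  have h1 : PreservesLimitsOfSize.{0, 0} F := adj'.rightAdjoint_preservesLimits
  have h2 : PreservesColimitsOfSize.{0, 0} F := adj.leftAdjoint_preservesColimits
  exact ⟨F.additive_of_preserves_binary_products, inferInstance, inferInstance⟩

namespace IsFrobeniusPair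

variable {F : C ⥤ D} {G : D ⥤ C} (h : IsFrobeniusPair F G)

include h

lemma ses_map {X Y Z : C} {f : X ⟶ Y} {g : Y ⟶ Z} (hS : SES f g) :
    SES (F.map f) (F.map g) := by
  obtain ⟨_, _, _⟩ := h.exists_preserves
  exact hS.map F

lemma preservesEpimorphisms : F.PreservesEpimorphisms := by
  obtain ⟨_, _, _⟩ := h.exists_preserves
  infer_instance

lemma projective_obj (P : C) [Projective P] : Projective (F.obj P) :=
  have := h.symm.preservesEpimorphisms
  h.1.some.map_projective P inferInstance

variable [EnoughProjectives C]

lemma isPerp_obj {X : C} (hX : IsPerp X) : IsPerp (F.obj X) := by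
  obtain ⟨_, _, _⟩ := h.exists_preserves
  have := HasExt.standard C
  have := HasExt.standard D
  have := h.symm.preservesEpimorphisms
  intro Q hQ n
  exact (extVanish_adjunction h.1.some Q n X).2 (hX _ (h.symm.projective_obj Q) n)

/-- The adjunction gives vanishing into `G.obj (F.obj Q)`, of which `Q` is a retract. -/
lemma isPerp_of_obj [F.Faithful] {X : C} (hX : IsPerp (F.obj X)) : IsPerp X := by
  obtain ⟨_, _, _⟩ := h.exists_preserves
  have := HasExt.standard C
  have := HasExt.standard D
  have := h.symm.preservesEpimorphisms
  intro Q hQ n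
  exact ((extVanish_adjunction h.1.some (F.obj Q) n X).1
    (hX _ (h.projective_obj Q) n)).of_retract_right (h.nonempty_retract Q).some

variable [EnoughProjectives D]

lemma isGorensteinProjective_obj {X : C} (hX : IsGorensteinProjective X) :
    IsGorensteinProjective (F.obj X) := by
  refine IsGorensteinProjective.of_class
    (fun Y => ∃ X, IsGorensteinProjective X ∧ F.obj X = Y) ?_ ?_ ⟨X, hX, rfl⟩
  · rintro _ ⟨X, hX, rfl⟩
    exact h.isPerp_obj hX.isPerp
  · rintro _ ⟨X, hX, rfl⟩
    obtain ⟨P, N, f, g, hP, hS, hN⟩ := hX.exists_cosyzygy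
    exact ⟨_, _, _, _, h.projective_obj P, h.ses_map hS, N, hN, rfl⟩

lemma gpdLE_obj {n : ℕ} : ∀ {X : C}, GpdLE n X → GpdLE n (F.obj X) := by
  induction n with
  | zero => exact h.isGorensteinProjective_obj
  | succ n ih =>
    rintro X ⟨K, H, f, g, hH, hS, hK⟩
    exact ⟨_, _, _, _, h.isGorensteinProjective_obj hH, h.ses_map hS, ih hK⟩

variable [F.Faithful]

lemma isGorensteinProjective_of_obj {X : C} (hX : IsGorensteinProjective (F.obj X)) :
    IsGorensteinProjective X := by
  refine IsGorensteinProjective.of_class (fun X => IsGorensteinProjective (F.obj X))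
    (fun X hX => h.isPerp_of_obj hX.isPerp) (fun X hX => ?_) hX
  obtain ⟨adj⟩ := h.1
  obtain ⟨P, N, i, p, hP, hip, hN⟩ := (h.symm.isGorensteinProjective_obj hX).exists_cosyzygy
  have := hip.mono
  -- The unit is monic because the left adjoint `F` is faithful.
  have hS := SES.cokernel (adj.unit.app X ≫ i)
  refine ⟨P, _, _, _, hP, hS, ?_⟩
  have := h.projective_obj P
  have hY : IsPerp (cokernel (adj.unit.app X ≫ i)) := by
    refine (h.isPerp_of_obj hX.isPerp).right hS fun Q hQ k => ?_
    obtain ⟨r⟩ := h.nonempty_retract Q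
    have := h.projective_obj Q
    have := h.symm.projective_obj (F.obj Q)
    -- By adjunction `k ≫ r.i` factors through the unit; the factor extends along `i` since `N` is
    -- perp, and `r.r` returns to `Q`.
    obtain ⟨l, hl⟩ := hN.isPerp.exists_extension hip (G.map ((adj.homEquiv _ _).symm (k ≫ r.i)))
    refine ⟨l ≫ r.r, ?_⟩
    have hk : adj.unit.app X ≫ G.map ((adj.homEquiv _ _).symm (k ≫ r.i)) = k ≫ r.i :=
      (adj.homEquiv_unit ..).symm.trans (Equiv.apply_symm_apply _ _)
    rw [Category.assoc, reassoc_of% hl, reassoc_of% hk, r.retract, Category.comp_id]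
  exact hX.cokernel_of_isPerp (h.ses_map hS) (h.isPerp_obj hY)

lemma gpdLE_of_obj {n : ℕ} : ∀ {X : C}, GpdLE n (F.obj X) → GpdLE n X := by
  induction n with
  | zero => exact h.isGorensteinProjective_of_obj
  | succ n ih =>
    intro X hX
    have hS := SES.kernel (Projective.π X)
    have := h.projective_obj (Projective.over X)
    exact ⟨_, _, _, _, IsGorensteinProjective.of_projective _, hS, ih (hX.syzygy (h.ses_map hS))⟩

end IsFrobeniusPair

end Frobenius

end GorensteinHomological

theorem mainTheorem3 {C : Type u} [Category.{v} C] [Abelian C] [EnoughProjectives C]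
    {D : Type u'} [Category.{v'} D] [Abelian D] [EnoughProjectives D]
    (F : C ⥤ D) (G : D ⥤ C) (hFG : GorensteinHomological.IsFrobeniusPair F G)
    (hF : F.Faithful) (X : C) :
    GorensteinHomological.Gpd X = GorensteinHomological.Gpd (F.obj X) := by
  have key (n : ℕ) : GorensteinHomological.Gpd X ≤ n ↔
      GorensteinHomological.Gpd (F.obj X) ≤ n := by
    rw [GorensteinHomological.gpd_le_iff, GorensteinHomological.gpd_le_iff]
    exact ⟨fun h => (hFG.gpdLE_obj h.gpdLE).hasGpdLE,
      fun h => (hFG.gpdLE_of_obj h.gpdLE).hasGpdLE⟩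
  refine le_antisymm ?_ ?_
  · cases h : GorensteinHomological.Gpd (F.obj X) with
    | top => exact le_top
    | coe n => exact (key n).2 h.le
  · cases h : GorensteinHomological.Gpd X with
    | top => exact le_top
    | coe n => exact (key n).1 h.le
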